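/- Let $1\le K\le D$ and $C\ge 1$ be integers. For $u\in\mathbb{R}^K$ and $v\in\mathbb{R}^D$ let $u\star v\in\mathbb{R}^D$ be given by $(u\star v)[d]=\frac{1}{\sqrt D}\sum_{k=0}^{K-1}u[k]\,v[(d+k)\bmod D]$ for $0\le d<D$, and let $v^{\downarrow}[d]=v[D-d-1]$. For $U\in\mathbb{R}^{K\times C}$ and $V\in\mathbb{R}^{D\times C}$, the two-layer linear convolutional network $x\mapsto\sum_{c=0}^{C-1}\langle V[:,c],\,U[:,c]\star x\rangle$ on $\mathbb{R}^D$ realizes the linear predictor $w(U,V)=\sum_{c=0}^{C-1}\big(U[:,c]\star V[:,c]^{\downarrow}\big)^{\downarrow}\in\mathbb{R}^D$. For $w\in\mathbb{R}^D$ let $$R_{K,C}(w)=\min\big\{\|U\|_F^2+\|V\|_F^2 \,:\, U\in\mathbb{R}^{K\times C},\ V\in\mathbb{R}^{D\times C},\ w(U,V)=w\big\},$$ and let $\hat w=Fw\in\mathbb{C}^D$, where $F[k,l]=\frac{1}{\sqrt D}e^{-2\pi i kl/D}$ for $0\le k,l<D$ is the unitary DFT matrix. Then, for every $w\in\mathbb{R}^D$,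 the minimum defining $R_{K,C}(w)$ is attained, and $$2\sqrt{\tfrac{D}{K}}\,\|\hat w\|_2\le R_{K,C}(w)\le 2\sqrt{D}\,\|\hat w\|_2,\qquad 2\|\hat w\|_1\le R_{K,C}(w)\le 2\sqrt{\lceil D/K\rceil}\,\|\hat w\|_1 .$$ -/

import Mathlib

namespace ConvNet

/-- Circular convolution `u ⋆ v ∈ ℝ^D` of `u ∈ ℝ^K` and `v ∈ ℝ^D`:
`(u ⋆ v)[d] = (1 / √D) ∑_{k < K} u[k] v[(d + k) mod D]`. -/
noncomputable def circConv {K D : ℕ} (u : Fin K → ℝ) (v : Fin D → ℝ) : Fin D → ℝ :=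
  fun d => 1 / Real.sqrt (D : ℝ) *
    ∑ k : Fin K, u k * v ⟨((d : ℕ) + (k : ℕ)) % D, Nat.mod_lt _ d.pos⟩

/-- The flipped vector `z↓[d] = z[D - d - 1]`. -/
def flip {D : ℕ} (z : Fin D → ℝ) : Fin D → ℝ := fun d => z d.rev

/-- The two-layer linear convolutional network with `C` output channels:
`Φ(U, V; x) = ∑_c ⟨V[:, c], U[:, c] ⋆ x⟩`. -/
noncomputable def network {D K C : ℕ} (U : Matrix (Fin K) (Fin C) ℝ)
    (V : Matrix (Fin D) (Fin C) ℝ) (x : Fin D → ℝ) : ℝ :=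
  ∑ c : Fin C, ∑ d : Fin D, V d c * circConv (fun k => U k c) x d

/-- The linear predictor realized by the network:
`w(U, V) = ∑_c (U[:, c] ⋆ V[:, c]↓)↓`. -/
noncomputable def predictor {D K C : ℕ} (U : Matrix (Fin K) (Fin C) ℝ)
    (V : Matrix (Fin D) (Fin C) ℝ) : Fin D → ℝ :=
  ∑ c : Fin C, flip (circConv (fun k => U k c) (flip fun d => V d c))

/-- `w(U, V)` is the vector with `Φ(U, V; x) = ⟨w(U, V), x⟩` for all `x`. -/
theorem network_eq_predictor {D K C : ℕ} (U : Matrix (Fin K) (Fin C) ℝ)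
    (V : Matrix (Fin D) (Fin C) ℝ) (x : Fin D → ℝ) :
    network U V x = ∑ d : Fin D, predictor U V d * x d := by
  rcases Nat.eq_zero_or_pos D with rfl | hD
  · simp [network]
  have : NeZero D := ⟨hD.ne'⟩
  simp only [network, predictor, Finset.sum_apply, Finset.sum_mul]
  rw [Finset.sum_comm (s := (Finset.univ : Finset (Fin D)))]
  refine Finset.sum_congr rfl fun c _ => ?_
  simp only [circConv, flip, Finset.mul_sum, Finset.sum_mul]
  rw [Finset.sum_comm]
  conv_rhs => rw [Finset.sum_comm]
  refine Finset.sum_congr rfl fun k _ => ?_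
  refine Fintype.sum_equiv (Equiv.addRight (Fin.ofNat D (k : ℕ))) _ _ fun d => ?_
  have h1 : (Equiv.addRight (Fin.ofNat D (k : ℕ))) d
      = ⟨((d : ℕ) + (k : ℕ)) % D, Nat.mod_lt _ hD⟩ := by
    apply Fin.ext
    simp [Fin.val_add]
  rw [h1]
  have h2 : (Fin.rev (⟨(((Fin.rev (⟨((d : ℕ) + (k : ℕ)) % D, Nat.mod_lt _ hD⟩ : Fin D) : Fin D) : ℕ)
      + (k : ℕ)) % D, Nat.mod_lt _ hD⟩ : Fin D)) = d := by
    apply Fin.ext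
    simp only [Fin.val_rev]
    have hd := d.isLt
    have ha := Nat.mod_lt ((d : ℕ) + (k : ℕ)) hD
    have e1 := Nat.div_add_mod ((d : ℕ) + (k : ℕ)) D
    have e2 : (D - (((d : ℕ) + (k : ℕ)) % D + 1) + (k : ℕ))
        = (D - 1 - (d : ℕ)) + D * (((d : ℕ) + (k : ℕ)) / D) := by omega
    rw [e2, Nat.add_mul_mod_self_left, Nat.mod_eq_of_lt (by omega)]
    omega
  rw [h2]
  ring

/-- The values `‖U‖² + ‖V‖²` (squared Frobenius norms) over all weights
`U ∈ ℝ^{K × C}`, `V ∈ ℝ^{D × C}` with `w(U, V) = w`. -/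
def costs {D : ℕ} (K C : ℕ) (w : Fin D → ℝ) : Set ℝ :=
  {r | ∃ (U : Matrix (Fin K) (Fin C) ℝ) (V : Matrix (Fin D) (Fin C) ℝ),
    predictor U V = w ∧ r = (∑ k, ∑ c, U k c ^ 2) + ∑ d, ∑ c, V d c ^ 2}

/-- The induced regularizer `R_{K,C}(w)`, the least cost of a representation of `w`. -/
noncomputable def inducedReg {D : ℕ} (K C : ℕ) (w : Fin D → ℝ) : ℝ := sInf (costs K C w)

/-- The unitary DFT matrix `F[k, l] = (1 / √D) exp(-2πi k l / D)`. -/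
noncomputable def dftMatrix (D : ℕ) : Matrix (Fin D) (Fin D) ℂ :=
  Matrix.of fun k l => 1 / (Real.sqrt (D : ℝ) : ℂ) *
    Complex.exp (-2 * (Real.pi : ℂ) * Complex.I * ((k : ℕ) : ℂ) * ((l : ℕ) : ℂ) / (D : ℂ))

/-- The Fourier representation `ŵ = F w`. -/
noncomputable def dft {D : ℕ} (w : Fin D → ℝ) : Fin D → ℂ :=
  Matrix.mulVec (dftMatrix D) fun d => (w d : ℂ)

end ConvNet

/-! The two flips turn the correlation `circConv` into genuine circular convolution, so on the
Fourier side the predictor is `∑ c, û_c · v̂_c`, with `û_c` the DFT of the zero-padded filter.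
Parseval (valid as `K ≤ D`) keeps the cost unchanged.

Lower bounds: AM-GM at each frequency gives the ℓ¹ bound (`l1_le_of_mem_costs`); Cauchy–Schwarz in
the signal domain gives the ℓ² bound (`sum_predictor_sq_le`). The minimum exists because sublevel
sets of the cost are compact.

Upper bounds need a single channel, rescaled to balance its factors (`inducedReg_le_two_mul_sqrt`).
A delta filter gives the ℓ² bound. For ℓ¹, the ideal filter `x` has `|x̂|² = |ŵ|` but length `D`.
Cut it into `m = ⌈D/K⌉` windows of length `K`; `m` times the sum of their power spectra dominates
`|ŵ|`. A Fejér–Riesz argument (`exists_powerSpectrum_add`) merges the windows into one filter `q` of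
length `K` with that summed spectrum and `‖q‖² = ‖ŵ‖₁`. Then `v̂ = ŵ / q̂` has `‖v‖² ≤ m ‖ŵ‖₁`. -/

namespace ConvNet

/-! ### The DFT of zero-padded vectors -/

/-- The primitive `D`-th root of unity `exp(-2πi / D)`. -/
noncomputable def dftRoot (D : ℕ) : ℂ := (Complex.exp (2 * Real.pi * Complex.I / D))⁻¹

theorem isPrimitiveRoot_dftRoot (D : ℕ) [NeZero D] : IsPrimitiveRoot (dftRoot D) D :=
  (Complex.isPrimitiveRoot_exp D (NeZero.ne D)).inv

theorem norm_dftRoot (D : ℕ) [NeZero D] : ‖dftRoot D‖ = 1 :=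
  (isPrimitiveRoot_dftRoot D).norm'_eq_one (NeZero.ne D)

theorem conj_dftRoot (D : ℕ) [NeZero D] : (starRingEnd ℂ) (dftRoot D) = (dftRoot D)⁻¹ :=
  (Complex.inv_eq_conj (norm_dftRoot D)).symm

/-- The unitary DFT of size `D` of a vector of length `K`, padded with zeros. -/
noncomputable def fourierMap (D K : ℕ) : (Fin K → ℂ) →ₗ[ℂ] (Fin D → ℂ) :=
  (Matrix.of fun (k : Fin D) (j : Fin K) =>
    1 / (Real.sqrt (D : ℝ) : ℂ) * dftRoot D ^ ((k : ℕ) * (j : ℕ))).mulVecLin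

theorem fourierMap_apply {D K : ℕ} (u : Fin K → ℂ) (k : Fin D) :
    fourierMap D K u k =
      1 / (Real.sqrt (D : ℝ) : ℂ) * ∑ j : Fin K, dftRoot D ^ ((k : ℕ) * (j : ℕ)) * u j := by
  simp only [fourierMap, Matrix.mulVecLin_apply, Matrix.mulVec, dotProduct, Matrix.of_apply,
    Finset.mul_sum, mul_assoc]

theorem dft_eq_fourierMap {D : ℕ} (w : Fin D → ℝ) :
    dft w = fourierMap D D fun d => (w d : ℂ) := by
  funext k
  rw [fourierMap_apply]
  simp only [dft, dftMatrix, Matrix.mulVec, dotProduct, Matrix.of_apply, Finset.mul_sum]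
  refine Finset.sum_congr rfl fun l _ => ?_
  rw [mul_assoc, dftRoot, ← Complex.exp_neg, ← Complex.exp_nat_mul]
  congr 3
  push_cast
  ring

/-- A geometric sum with ratio `ζ ^ (j - i)`, which is not `1` for distinct `i, j < D` by
primitivity. -/
theorem sum_dftRoot_pow {D : ℕ} [NeZero D] {i j : ℕ} (hi : i < D) (hj : j < D) :
    ∑ k : Fin D, (starRingEnd ℂ) (dftRoot D ^ ((k : ℕ) * i)) * dftRoot D ^ ((k : ℕ) * j) =
      if i = j then (D : ℂ) else 0 := by
  have hz := isPrimitiveRoot_dftRoot D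
  have h0 : dftRoot D ≠ 0 := hz.ne_zero (NeZero.ne D)
  have key : ∀ k : Fin D, (starRingEnd ℂ) (dftRoot D ^ ((k : ℕ) * i)) * dftRoot D ^ ((k : ℕ) * j)
      = ((dftRoot D ^ i)⁻¹ * dftRoot D ^ j) ^ (k : ℕ) := by
    intro k
    rw [map_pow, conj_dftRoot, mul_pow, inv_pow, inv_pow, ← pow_mul, ← pow_mul, mul_comm _ i,
      mul_comm _ j]
  simp_rw [key]
  rw [Fin.sum_univ_eq_sum_range (fun n => ((dftRoot D ^ i)⁻¹ * dftRoot D ^ j) ^ n) D]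
  split_ifs with h
  · subst h
    simp [inv_mul_cancel₀ (pow_ne_zero i h0)]
  · have h1 : (dftRoot D ^ i)⁻¹ * dftRoot D ^ j - 1 ≠ 0 := by
      intro h2
      have : dftRoot D ^ j = dftRoot D ^ i := by
        have := sub_eq_zero.1 h2
        field_simp at this
        exact this
      exact h (hz.pow_inj hi hj this.symm)
    have h2 := mul_geom_sum ((dftRoot D ^ i)⁻¹ * dftRoot D ^ j) D
    have h3 : ((dftRoot D ^ i)⁻¹ * dftRoot D ^ j) ^ D = 1 := by
      rw [mul_pow, inv_pow, ← pow_mul, ← pow_mul, mul_comm i, mul_comm j, pow_mul, pow_mul,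
        hz.pow_eq_one]
      simp
    rw [h3, sub_self] at h2
    exact (mul_eq_zero.1 h2).resolve_left h1

/-- For `K ≤ D` the columns are distinct columns of a unitary matrix. -/
theorem parseval {D K : ℕ} [NeZero D] (hKD : K ≤ D) (u : Fin K → ℂ) :
    ∑ k, ‖fourierMap D K u k‖ ^ 2 = ∑ j, ‖u j‖ ^ 2 := by
  have hD : (D : ℂ) ≠ 0 := Nat.cast_ne_zero.2 (NeZero.ne D)
  have hs : (Real.sqrt (D : ℝ) : ℂ) * (Real.sqrt (D : ℝ) : ℂ) = D := by
    rw [← Complex.ofReal_mul, Real.mul_self_sqrt (Nat.cast_nonneg D)]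
    simp
  have hs0 : (Real.sqrt (D : ℝ) : ℂ) ≠ 0 := by
    intro h
    rw [h] at hs
    exact hD (by simpa using hs.symm)
  have : ∑ k, (starRingEnd ℂ) (fourierMap D K u k) * fourierMap D K u k
      = ∑ j, (starRingEnd ℂ) (u j) * u j := by
    have e : ∀ k : Fin D, (starRingEnd ℂ) (fourierMap D K u k) * fourierMap D K u k
        = 1 / (D : ℂ) * ∑ i : Fin K, ∑ j : Fin K, (starRingEnd ℂ) (u i) * u j *
          ((starRingEnd ℂ) (dftRoot D ^ ((k : ℕ) * (i : ℕ))) * dftRoot D ^ ((k : ℕ) * (j : ℕ))) := by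
      intro k
      simp only [fourierMap_apply, map_mul, map_sum, map_div₀, map_one, Complex.conj_ofReal]
      rw [mul_mul_mul_comm, Finset.sum_mul_sum, ← hs]
      congr 1
      · field_simp
      · refine Finset.sum_congr rfl fun i _ => Finset.sum_congr rfl fun j _ => ?_
        ring
    simp_rw [e]
    rw [← Finset.mul_sum, Finset.sum_comm]
    simp_rw [Finset.sum_comm (s := (Finset.univ : Finset (Fin D))), ← Finset.mul_sum]
    simp_rw [sum_dftRoot_pow (lt_of_lt_of_le (Fin.isLt _) hKD) (lt_of_lt_of_le (Fin.isLt _) hKD)]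
    simp only [← Fin.ext_iff, mul_ite, mul_zero, Finset.sum_ite_eq, Finset.mem_univ, if_true]
    rw [← Finset.sum_mul]
    field_simp
  have h2 : ((∑ k, ‖fourierMap D K u k‖ ^ 2 : ℝ) : ℂ) = ((∑ j, ‖u j‖ ^ 2 : ℝ) : ℂ) := by
    push_cast
    simpa only [Complex.conj_mul'] using this
  exact_mod_cast h2

theorem fourierMap_injective (D : ℕ) [NeZero D] : Function.Injective (fourierMap D D) := by
  rw [injective_iff_map_eq_zero]
  intro u hu
  have h := parseval le_rfl u
  simp only [hu, Pi.zero_apply, norm_zero] at h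
  have h' := (Finset.sum_eq_zero_iff_of_nonneg (fun i _ => sq_nonneg ‖u i‖)).1
    (h.symm.trans (by simp))
  funext i
  simpa using h' i (Finset.mem_univ i)

theorem fourierMap_surjective (D : ℕ) [NeZero D] : Function.Surjective (fourierMap D D) :=
  LinearMap.surjective_of_injective (fourierMap_injective D)

theorem dftRoot_pow_val_add {D : ℕ} [NeZero D] (a b : Fin D) :
    dftRoot D ^ ((a + b : Fin D) : ℕ) = dftRoot D ^ (a : ℕ) * dftRoot D ^ (b : ℕ) := by
  rw [Fin.val_add, ← pow_add]
  exact (pow_eq_pow_mod _ (isPrimitiveRoot_dftRoot D).pow_eq_one).symm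

theorem dftRoot_pow_val_neg {D : ℕ} [NeZero D] (a : Fin D) :
    dftRoot D ^ ((-a : Fin D) : ℕ) = (dftRoot D ^ (a : ℕ))⁻¹ := by
  refine eq_inv_of_mul_eq_one_left ?_
  rw [← dftRoot_pow_val_add]
  simp

/-- Used both to see that `|ŵ|` is even and to recognize real vectors from their spectra. -/
theorem fourierMap_conj {D K : ℕ} [NeZero D] (u : Fin K → ℂ) (k : Fin D) :
    fourierMap D K (fun j => (starRingEnd ℂ) (u j)) k =
      (starRingEnd ℂ) (fourierMap D K u (-k)) := by
  simp only [fourierMap_apply, map_mul, map_sum, map_div₀, map_one, Complex.conj_ofReal]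
  congr 1
  refine Finset.sum_congr rfl fun j _ => ?_
  rw [pow_mul, pow_mul, dftRoot_pow_val_neg, map_pow, map_inv₀, map_pow, conj_dftRoot]
  simp

/-! ### Convolution and the predictor -/

/-- The circular convolution `(1 / √D) ∑_k u[k] v[d - k]`. -/
noncomputable def cyclicConv {K D : ℕ} [NeZero D] (u : Fin K → ℂ) (v : Fin D → ℂ) : Fin D → ℂ :=
  fun d => 1 / (Real.sqrt (D : ℝ) : ℂ) * ∑ k : Fin K, u k * v (d - Fin.ofNat D (k : ℕ))

theorem fourierMap_cyclicConv {K D : ℕ} [NeZero D] (u : Fin K → ℂ) (v : Fin D → ℂ) (k : Fin D) :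
    fourierMap D D (cyclicConv u v) k = fourierMap D K u k * fourierMap D D v k := by
  rw [fourierMap_apply, fourierMap_apply, fourierMap_apply, mul_mul_mul_comm, Finset.sum_mul_sum,
    mul_assoc]
  congr 1
  simp only [cyclicConv, Finset.mul_sum]
  rw [Finset.sum_comm]
  refine Finset.sum_congr rfl fun j _ => ?_
  refine Fintype.sum_equiv (Equiv.subRight (Fin.ofNat D (j : ℕ))) _ _ fun d => ?_
  have h : dftRoot D ^ ((k : ℕ) * (d : ℕ)) = dftRoot D ^ ((k : ℕ) * (j : ℕ)) *
      dftRoot D ^ ((k : ℕ) * ((d - Fin.ofNat D (j : ℕ) : Fin D) : ℕ)) := by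
    have h1 := dftRoot_pow_val_add (d - Fin.ofNat D (j : ℕ)) (Fin.ofNat D (j : ℕ))
    rw [sub_add_cancel, Fin.val_ofNat,
      ← pow_eq_pow_mod _ (isPrimitiveRoot_dftRoot D).pow_eq_one] at h1
    rw [mul_comm (k : ℕ) (d : ℕ), pow_mul, h1, mul_pow, ← pow_mul, ← pow_mul, mul_comm, mul_comm (j : ℕ),
      mul_comm (k : ℕ) ((d - _ : Fin D) : ℕ)]
  rw [h]
  simp only [Equiv.subRight_apply]
  ring

theorem rev_add_mod_eq_sub {D : ℕ} [NeZero D] (d : Fin D) (k : ℕ) (h : (d.rev + k) % D < D) :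
    (⟨(d.rev + k) % D, h⟩ : Fin D).rev = d - Fin.ofNat D k := by
  rw [eq_sub_iff_add_eq]
  apply Fin.ext
  rw [Fin.val_add, Fin.val_ofNat, Nat.add_mod_mod]
  simp only [Fin.val_rev] at h ⊢
  have hd := d.isLt
  have e1 := Nat.div_add_mod (D - (d + 1) + k) D
  have e2 : D - ((D - (d + 1) + k) % D + 1) + k = d + D * ((D - (d + 1) + k) / D) := by omega
  rw [e2, Nat.add_mul_mod_self_left, Nat.mod_eq_of_lt hd]

theorem predictor_apply {D K C : ℕ} [NeZero D] (U : Matrix (Fin K) (Fin C) ℝ)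
    (V : Matrix (Fin D) (Fin C) ℝ) (d : Fin D) :
    predictor U V d =
      ∑ c, 1 / Real.sqrt (D : ℝ) * ∑ k : Fin K, U k c * V (d - Fin.ofNat D (k : ℕ)) c := by
  simp only [predictor, Finset.sum_apply, flip, circConv, rev_add_mod_eq_sub]

theorem ofReal_predictor {D K C : ℕ} [NeZero D] (U : Matrix (Fin K) (Fin C) ℝ)
    (V : Matrix (Fin D) (Fin C) ℝ) :
    (fun d => (predictor U V d : ℂ)) =
      ∑ c, cyclicConv (fun k => (U k c : ℂ)) (fun d => (V d c : ℂ)) := by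
  funext d
  rw [predictor_apply]
  simp [cyclicConv]

theorem dft_predictor {D K C : ℕ} [NeZero D] (U : Matrix (Fin K) (Fin C) ℝ)
    (V : Matrix (Fin D) (Fin C) ℝ) (k : Fin D) :
    dft (predictor U V) k = ∑ c, fourierMap D K (fun k => (U k c : ℂ)) k *
      fourierMap D D (fun d => (V d c : ℂ)) k := by
  rw [dft_eq_fourierMap, ofReal_predictor, map_sum, Finset.sum_apply]
  simp only [fourierMap_cyclicConv]

/-! ### Costs and single-channel representations -/

theorem norm_sq_dft {D : ℕ} [NeZero D] (w : Fin D → ℝ) :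
    ‖WithLp.toLp 2 (dft w)‖ ^ 2 = ∑ d, w d ^ 2 := by
  rw [EuclideanSpace.norm_sq_eq]
  simp only [dft_eq_fourierMap]
  rw [parseval le_rfl]
  simp

theorem norm_dft_eq_sqrt {D : ℕ} [NeZero D] (w : Fin D → ℝ) :
    ‖WithLp.toLp 2 (dft w)‖ = Real.sqrt (∑ d, w d ^ 2) := by
  rw [← norm_sq_dft, Real.sqrt_sq (norm_nonneg _)]

theorem norm_one_dft {D : ℕ} (w : Fin D → ℝ) :
    ‖WithLp.toLp 1 (dft w)‖ = ∑ k, ‖dft w k‖ := by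
  rw [PiLp.norm_eq_of_L1]

theorem costs_nonneg {D K C : ℕ} {w : Fin D → ℝ} {r : ℝ} (hr : r ∈ costs K C w) : 0 ≤ r := by
  obtain ⟨U, V, -, rfl⟩ := hr
  positivity

theorem inducedReg_le_of_mem {D K C : ℕ} {w : Fin D → ℝ} {r : ℝ} (hr : r ∈ costs K C w) :
    inducedReg K C w ≤ r :=
  csInf_le ⟨0, fun _ h => costs_nonneg h⟩ hr

theorem sum_sq_mem_costs {D K C : ℕ} [NeZero D] (hC : 1 ≤ C) {w : Fin D → ℝ} (u : Fin K → ℝ)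
    (v : Fin D → ℝ)
    (h : cyclicConv (fun k => (u k : ℂ)) (fun d => (v d : ℂ)) = fun d => (w d : ℂ)) :
    ∑ k, u k ^ 2 + ∑ d, v d ^ 2 ∈ costs K C w := by
  obtain ⟨n, rfl⟩ : ∃ n, C = n + 1 := ⟨C - 1, by omega⟩
  refine ⟨fun k c => if c = 0 then u k else 0, fun d c => if c = 0 then v d else 0, ?_, ?_⟩
  · have h1 := ofReal_predictor (fun (k : Fin K) (c : Fin (n + 1)) => if c = 0 then u k else 0)
      (fun (d : Fin D) (c : Fin (n + 1)) => if c = 0 then v d else 0)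
    rw [Fin.sum_univ_succ, Finset.sum_eq_zero (fun i _ => ?_), add_zero] at h1
    · simp only [if_true] at h1
      funext d
      exact_mod_cast congrFun (h1.trans h) d
    · funext d
      simp [cyclicConv]
  · simp [ite_pow]

/-- Replacing `(u, v)` by `(t u, t⁻¹ v)` preserves the convolution; `t² = ‖v‖ / ‖u‖` makes AM-GM an
equality. -/
theorem inducedReg_le_two_mul_sqrt {D K C : ℕ} [NeZero D] (hC : 1 ≤ C) {w : Fin D → ℝ}
    (u : Fin K → ℝ) (v : Fin D → ℝ)
    (h : cyclicConv (fun k => (u k : ℂ)) (fun d => (v d : ℂ)) = fun d => (w d : ℂ)) :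
    inducedReg K C w ≤ 2 * (Real.sqrt (∑ k, u k ^ 2) * Real.sqrt (∑ d, v d ^ 2)) := by
  have hA : 0 ≤ ∑ k, u k ^ 2 := Finset.sum_nonneg fun _ _ => sq_nonneg _
  have hB : 0 ≤ ∑ d, v d ^ 2 := Finset.sum_nonneg fun _ _ => sq_nonneg _
  -- If a factor vanishes, no balancing `t` exists, but then `w = 0` and the zero pair costs
  -- nothing.
  by_cases h0 : ∑ k, u k ^ 2 = 0 ∨ ∑ d, v d ^ 2 = 0
  · have hw : cyclicConv (fun k : Fin K => (((0 : Fin K → ℝ) k : ℝ) : ℂ))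
        (fun d : Fin D => (((0 : Fin D → ℝ) d : ℝ) : ℂ)) = fun d => (w d : ℂ) := by
      rw [← h]
      rcases h0 with h0 | h0
      · have : u = 0 := by
          funext i
          simpa using (Finset.sum_eq_zero_iff_of_nonneg (fun i _ => sq_nonneg (u i))).1 h0 i
            (Finset.mem_univ i)
        subst this
        funext d
        simp [cyclicConv]
      · have : v = 0 := by
          funext i
          simpa using (Finset.sum_eq_zero_iff_of_nonneg (fun i _ => sq_nonneg (v i))).1 h0 i
            (Finset.mem_univ i)
        subst this
        funext d
        simp [cyclicConv]
    refine (inducedReg_le_of_mem (sum_sq_mem_costs (K := K) hC 0 0 hw)).trans ?_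
    simp only [Pi.zero_apply, ne_eq, OfNat.ofNat_ne_zero, not_false_eq_true, zero_pow,
      Finset.sum_const_zero, add_zero]
    positivity
  · push Not at h0
    set a := Real.sqrt (∑ k, u k ^ 2) with ha
    set b := Real.sqrt (∑ d, v d ^ 2) with hb
    have hap : 0 < a := Real.sqrt_pos.2 (lt_of_le_of_ne hA h0.1.symm)
    have hbp : 0 < b := Real.sqrt_pos.2 (lt_of_le_of_ne hB h0.2.symm)
    have ha2 : ∑ k, u k ^ 2 = a ^ 2 := (Real.sq_sqrt hA).symm
    have hb2 : ∑ d, v d ^ 2 = b ^ 2 := (Real.sq_sqrt hB).symm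
    set t := Real.sqrt (b / a) with ht
    have ht0 : 0 < t := Real.sqrt_pos.2 (div_pos hbp hap)
    have ht2 : t ^ 2 = b / a := Real.sq_sqrt (div_pos hbp hap).le
    have hw : cyclicConv (fun k => ((t * u k : ℝ) : ℂ)) (fun d => ((t⁻¹ * v d : ℝ) : ℂ))
        = fun d => (w d : ℂ) := by
      rw [← h]
      funext d
      simp only [cyclicConv]
      congr 1
      refine Finset.sum_congr rfl fun k _ => ?_
      have : (t : ℂ) ≠ 0 := by exact_mod_cast ht0.ne'
      push_cast
      field_simp
    refine (inducedReg_le_of_mem (sum_sq_mem_costs hC _ _ hw)).trans (le_of_eq ?_)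
    simp only [mul_pow, ← Finset.mul_sum, inv_pow]
    rw [ha2, hb2, ht2]
    field_simp
    ring

/-- The entry `√D` cancels the normalization, making this delta the identity for convolution. -/
theorem cyclicConv_single {D n : ℕ} [NeZero D] (w : Fin D → ℝ) :
    cyclicConv (fun k : Fin (n + 1) => ((if k = 0 then Real.sqrt D else 0 : ℝ) : ℂ))
      (fun d => (w d : ℂ)) = fun d => (w d : ℂ) := by
  funext d
  have : Real.sqrt (D : ℝ) ≠ 0 :=
    (Real.sqrt_pos.2 (Nat.cast_pos.2 (Nat.pos_of_neZero D))).ne'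
  have h' : (Real.sqrt (D : ℝ) : ℂ) ≠ 0 := by exact_mod_cast this
  rw [cyclicConv, Fin.sum_univ_succ]
  simp [Fin.succ_ne_zero, h']

theorem costs_nonempty {D K C : ℕ} [NeZero D] (hK : 1 ≤ K) (hC : 1 ≤ C) (w : Fin D → ℝ) :
    (costs K C w).Nonempty := by
  obtain ⟨n, rfl⟩ : ∃ n, K = n + 1 := ⟨K - 1, by omega⟩
  exact ⟨_, sum_sq_mem_costs hC _ w (cyclicConv_single w)⟩

theorem inducedReg_le_l2 {D K C : ℕ} [NeZero D] (hK : 1 ≤ K) (hC : 1 ≤ C) (w : Fin D → ℝ) :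
    inducedReg K C w ≤ 2 * Real.sqrt (D : ℝ) * ‖WithLp.toLp 2 (dft w)‖ := by
  obtain ⟨n, rfl⟩ : ∃ n, K = n + 1 := ⟨K - 1, by omega⟩
  have h := inducedReg_le_two_mul_sqrt hC _ w (cyclicConv_single (n := n) w)
  rw [norm_dft_eq_sqrt, mul_assoc]
  simpa [ite_pow, Real.sqrt_sq] using h

/-! ### Lower bounds -/

theorem l1_le_of_mem_costs {D K C : ℕ} [NeZero D] (hKD : K ≤ D) {w : Fin D → ℝ} {r : ℝ}
    (hr : r ∈ costs K C w) : 2 * ‖WithLp.toLp 1 (dft w)‖ ≤ r := by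
  obtain ⟨U, V, rfl, rfl⟩ := hr
  rw [norm_one_dft, Finset.sum_comm, Finset.sum_comm (s := (Finset.univ : Finset (Fin D))),
    Finset.mul_sum]
  have hU : ∀ c, ∑ k, U k c ^ 2 = ∑ k, ‖fourierMap D K (fun k => (U k c : ℂ)) k‖ ^ 2 := by
    intro c
    simp [parseval hKD]
  have hV : ∀ c, ∑ d, V d c ^ 2 = ∑ k, ‖fourierMap D D (fun d => (V d c : ℂ)) k‖ ^ 2 := by
    intro c
    simp [parseval le_rfl]
  simp_rw [hU, hV, ← Finset.sum_add_distrib]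
  rw [Finset.sum_comm]
  refine Finset.sum_le_sum fun k _ => ?_
  rw [dft_predictor]
  refine (mul_le_mul_of_nonneg_left (norm_sum_le _ _) zero_le_two).trans ?_
  rw [Finset.mul_sum]
  refine Finset.sum_le_sum fun c _ => ?_
  rw [norm_mul, ← mul_assoc]
  exact two_mul_le_add_sq _ _

/-- Cauchy–Schwarz over pairs `(k, c)` bounds each coordinate; summing over `d` counts every entry
of `V` once per shift, hence `K` times. -/
theorem sum_predictor_sq_le {D K C : ℕ} [NeZero D] (U : Matrix (Fin K) (Fin C) ℝ)
    (V : Matrix (Fin D) (Fin C) ℝ) :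
    D * ∑ d, predictor U V d ^ 2 ≤ K * ((∑ k, ∑ c, U k c ^ 2) * ∑ d, ∑ c, V d c ^ 2) := by
  have hD : (0 : ℝ) < D := Nat.cast_pos.2 (Nat.pos_of_neZero D)
  have h1 : ∀ d, D * predictor U V d ^ 2 ≤
      (∑ k, ∑ c, U k c ^ 2) * ∑ k : Fin K, ∑ c, V (d - Fin.ofNat D (k : ℕ)) c ^ 2 := by
    intro d
    rw [predictor_apply, ← Finset.mul_sum, mul_pow, div_pow, Real.sq_sqrt hD.le, ← mul_assoc,
      one_pow, mul_one_div_cancel hD.ne', one_mul, Finset.sum_comm]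
    simpa only [Fintype.sum_prod_type] using Finset.sum_mul_sq_le_sq_mul_sq
      (Finset.univ : Finset (Fin K × Fin C)) (fun i => U i.1 i.2)
      (fun i => V (d - Fin.ofNat D (i.1 : ℕ)) i.2)
  have h2 : ∑ d, ∑ k : Fin K, ∑ c, V (d - Fin.ofNat D (k : ℕ)) c ^ 2
      = K * ∑ d, ∑ c, V d c ^ 2 := by
    rw [Finset.sum_comm]
    have : ∀ k : Fin K, ∑ d, ∑ c, V (d - Fin.ofNat D (k : ℕ)) c ^ 2 = ∑ d, ∑ c, V d c ^ 2 :=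
      fun k => Fintype.sum_equiv (Equiv.subRight (Fin.ofNat D (k : ℕ))) _ _ fun d => rfl
    rw [Finset.sum_congr rfl fun k _ => this k]
    simp
  rw [Finset.mul_sum]
  refine (Finset.sum_le_sum fun d _ => h1 d).trans (le_of_eq ?_)
  rw [← Finset.mul_sum, h2]
  ring

theorem l2_le_of_mem_costs {D K C : ℕ} [NeZero D] (hK : 1 ≤ K) {w : Fin D → ℝ} {r : ℝ}
    (hr : r ∈ costs K C w) :
    2 * Real.sqrt ((D : ℝ) / (K : ℝ)) * ‖WithLp.toLp 2 (dft w)‖ ≤ r := by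
  have hr0 := costs_nonneg hr
  obtain ⟨U, V, rfl, rfl⟩ := hr
  have hK' : (0 : ℝ) < K := by exact_mod_cast hK
  refine le_of_sq_le_sq ?_ hr0
  rw [mul_pow, mul_pow, norm_sq_dft, Real.sq_sqrt (by positivity)]
  have h := sum_predictor_sq_le U V
  have h' : (D : ℝ) / K * ∑ d, predictor U V d ^ 2 ≤
      (∑ k, ∑ c, U k c ^ 2) * ∑ d, ∑ c, V d c ^ 2 := by
    rw [div_mul_eq_mul_div, div_le_iff₀' hK']
    exact h
  -- With `A`, `B` the two squared norms, this is `4AB ≤ (A + B)²`.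
  nlinarith [sq_nonneg ((∑ k, ∑ c, U k c ^ 2) - ∑ d, ∑ c, V d c ^ 2)]

/-! ### Compactness and attainment -/

theorem isCompact_of_sum_sq_le {ι κ : Type*} [Fintype ι] [Fintype κ]
    {s : Set ((ι → ℝ) × (κ → ℝ))} (hs : IsClosed s) (r : ℝ)
    (h : ∀ p ∈ s, ∑ i, p.1 i ^ 2 + ∑ j, p.2 j ^ 2 ≤ r) : IsCompact s := by
  refine Metric.isCompact_of_isClosed_isBounded hs ?_
  refine isBounded_iff_forall_norm_le.2 ⟨Real.sqrt r, fun p hp => ?_⟩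
  have h1 : 0 ≤ ∑ i, p.1 i ^ 2 := Finset.sum_nonneg fun _ _ => sq_nonneg _
  have h2 : 0 ≤ ∑ j, p.2 j ^ 2 := Finset.sum_nonneg fun _ _ => sq_nonneg _
  refine norm_prod_le_iff.2 ⟨?_, ?_⟩ <;>
    refine (pi_norm_le_iff_of_nonneg (Real.sqrt_nonneg r)).2 fun i => Real.abs_le_sqrt ?_
  · have := Finset.single_le_sum (fun i _ => sq_nonneg (p.1 i)) (Finset.mem_univ i)
    linarith [h p hp]
  · have := Finset.single_le_sum (fun i _ => sq_nonneg (p.2 i)) (Finset.mem_univ i)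
    linarith [h p hp]

theorem isLeast_costs {D K C : ℕ} [NeZero D] {w : Fin D → ℝ} (hne : (costs K C w).Nonempty) :
    IsLeast (costs K C w) (inducedReg K C w) := by
  suffices h : ∃ r, IsLeast (costs K C w) r by
    obtain ⟨r, hr⟩ := h
    rwa [inducedReg, hr.csInf_eq]
  obtain ⟨r₀, U₀, V₀, hw₀, hr₀⟩ := hne
  let f : (Fin K × Fin C → ℝ) × (Fin D × Fin C → ℝ) → ℝ :=
    fun p => ∑ i, p.1 i ^ 2 + ∑ j, p.2 j ^ 2
  let P : (Fin K × Fin C → ℝ) × (Fin D × Fin C → ℝ) → Fin D → ℝ :=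
    fun p => predictor (fun k c => p.1 (k, c)) (fun d c => p.2 (d, c))
  have hf : Continuous f := by fun_prop
  have hP : Continuous P := by
    refine continuous_pi fun d => ?_
    have : (fun p => P p d) = fun p => ∑ c, 1 / Real.sqrt (D : ℝ) *
        ∑ k : Fin K, p.1 (k, c) * p.2 (d - Fin.ofNat D (k : ℕ), c) :=
      funext fun p => predictor_apply _ _ _
    rw [this]
    fun_prop
  have hfs : ∀ p, f p = (∑ k, ∑ c, p.1 (k, c) ^ 2) + ∑ d, ∑ c, p.2 (d, c) ^ 2 := by
    intro p
    simp only [f, Fintype.sum_prod_type]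
  have hcpt : IsCompact {p | P p = w ∧ f p ≤ r₀} :=
    isCompact_of_sum_sq_le ((isClosed_eq hP continuous_const).inter
      (isClosed_le hf continuous_const)) r₀ fun p hp => hp.2
  have h0 : (fun i => U₀ i.1 i.2, fun j => V₀ j.1 j.2) ∈ {p | P p = w ∧ f p ≤ r₀} :=
    ⟨hw₀, by rw [hfs, hr₀]⟩
  obtain ⟨p, hp, hmin⟩ := hcpt.exists_isMinOn ⟨_, h0⟩ hf.continuousOn
  refine ⟨f p, ⟨_, _, hp.1, hfs p⟩, ?_⟩
  rintro r ⟨U, V, hw, hr⟩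
  by_cases hle : r ≤ r₀
  · have h1 : (fun i => U i.1 i.2, fun j => V j.1 j.2) ∈ {p | P p = w ∧ f p ≤ r₀} :=
      ⟨hw, by rw [hfs, ← hr]; exact hle⟩
    have := hmin h1
    rw [hr]
    refine le_trans this (le_of_eq (hfs _))
  · exact hp.2.trans (not_le.1 hle).le

/-! ### Power spectra and Fejér–Riesz -/

/-- The squared moduli of the DFT of a zero-padded real vector. -/
noncomputable def powerSpectrum (D : ℕ) {K : ℕ} (u : Fin K → ℝ) (k : Fin D) : ℝ :=
  ‖fourierMap D K (fun j => (u j : ℂ)) k‖ ^ 2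

theorem sum_powerSpectrum {D K : ℕ} [NeZero D] (hKD : K ≤ D) (u : Fin K → ℝ) :
    ∑ k, powerSpectrum D u k = ∑ j, u j ^ 2 := by
  simp [powerSpectrum, parseval hKD]

theorem continuous_powerSpectrum {D K : ℕ} (k : Fin D) :
    Continuous fun u : Fin K → ℝ => powerSpectrum D u k := by
  simp only [powerSpectrum, fourierMap_apply]
  fun_prop

/-- At each frequency the pair `(â, b̂)` undergoes a real rotation, which preserves `|â|² + |b̂|²`.
-/
theorem powerSpectrum_rotate {D K : ℕ} (a b : Fin K → ℝ) {c s : ℝ} (h : c ^ 2 + s ^ 2 = 1)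
    (k : Fin D) :
    powerSpectrum D (c • a + s • b) k + powerSpectrum D (c • b - s • a) k =
      powerSpectrum D a k + powerSpectrum D b k := by
  have h1 : fourierMap D K (fun j => (((c • a + s • b) j : ℝ) : ℂ)) k =
      c * fourierMap D K (fun j => (a j : ℂ)) k + s * fourierMap D K (fun j => (b j : ℂ)) k := by
    have : (fun j => (((c • a + s • b) j : ℝ) : ℂ)) =
        (c : ℂ) • (fun j => (a j : ℂ)) + (s : ℂ) • (fun j => (b j : ℂ)) := by
      funext j
      simp
    rw [this, map_add, map_smul, map_smul]
    rfl
  have h2 : fourierMap D K (fun j => (((c • b - s • a) j : ℝ) : ℂ)) k =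
      c * fourierMap D K (fun j => (b j : ℂ)) k - s * fourierMap D K (fun j => (a j : ℂ)) k := by
    have : (fun j => (((c • b - s • a) j : ℝ) : ℂ)) =
        (c : ℂ) • (fun j => (b j : ℂ)) - (s : ℂ) • (fun j => (a j : ℂ)) := by
      funext j
      simp
    rw [this, map_sub, map_smul, map_smul]
    rfl
  simp only [powerSpectrum, h1, h2, Complex.sq_norm, Complex.normSq_apply, Complex.add_re,
    Complex.add_im, Complex.sub_re, Complex.sub_im, Complex.re_ofReal_mul, Complex.im_ofReal_mul]
  generalize fourierMap D K (fun j => (a j : ℂ)) k = A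
  generalize fourierMap D K (fun j => (b j : ℂ)) k = B
  linear_combination (A.re ^ 2 + A.im ^ 2 + B.re ^ 2 + B.im ^ 2) * h

/-- A shift by one multiplies the transform by the unimodular `ζ ^ k`. -/
theorem powerSpectrum_cons_zero {D n : ℕ} [NeZero D] (t : Fin n → ℝ) (k : Fin D) :
    powerSpectrum D (Fin.cons 0 t : Fin (n + 1) → ℝ) k =
      powerSpectrum D (Fin.snoc t 0 : Fin (n + 1) → ℝ) k := by
  have : fourierMap D (n + 1) (fun j => (((Fin.cons 0 t : Fin (n + 1) → ℝ) j : ℝ) : ℂ)) k =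
      dftRoot D ^ (k : ℕ) *
        fourierMap D (n + 1) (fun j => (((Fin.snoc t 0 : Fin (n + 1) → ℝ) j : ℝ) : ℂ)) k := by
    rw [fourierMap_apply, fourierMap_apply, Fin.sum_univ_succ, Fin.sum_univ_castSucc,
      mul_left_comm]
    congr 1
    simp only [Fin.cons_zero, Fin.cons_succ, Fin.snoc_castSucc, Fin.snoc_last, Complex.ofReal_zero,
      mul_zero, zero_add, add_zero, Finset.mul_sum, Fin.val_succ, Fin.val_castSucc]
    refine Finset.sum_congr rfl fun j _ => ?_
    ring
  rw [powerSpectrum, this, norm_mul, norm_pow, norm_dftRoot, one_pow, one_mul, powerSpectrum]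

theorem exists_rotation (x y : ℝ) : ∃ c s : ℝ, c ^ 2 + s ^ 2 = 1 ∧ c * y - s * x = 0 := by
  by_cases h : x ^ 2 + y ^ 2 = 0
  · refine ⟨1, 0, by norm_num, ?_⟩
    have : y ^ 2 = 0 := le_antisymm (by nlinarith [sq_nonneg x]) (sq_nonneg y)
    simp [pow_eq_zero_iff two_ne_zero |>.1 this]
  · have h0 : 0 < x ^ 2 + y ^ 2 := lt_of_le_of_ne (by positivity) (Ne.symm h)
    refine ⟨x / Real.sqrt (x ^ 2 + y ^ 2), y / Real.sqrt (x ^ 2 + y ^ 2), ?_, by ring⟩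
    rw [div_pow, div_pow, Real.sq_sqrt h0.le, ← add_div, div_self h]

/-- A Fejér–Riesz theorem for sums of two squares: a sum of two power spectra of filters is the
power spectrum of a filter of the same length. The minimizer of `∑ j (a_j² + b_j²)` among the pairs
with given sum of spectra has, after a rotation, `b = 0`, as otherwise `b` could be shifted. -/
theorem exists_powerSpectrum_add {D K : ℕ} [NeZero D] (hKD : K ≤ D) (a b : Fin K → ℝ) :
    ∃ q : Fin K → ℝ, ∀ k, powerSpectrum D q k = powerSpectrum D a k + powerSpectrum D b k := by
  obtain _ | n := K
  · refine ⟨a, fun k => ?_⟩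
    rw [Subsingleton.elim b a]
    simp [powerSpectrum, fourierMap_apply]
  let S : Set ((Fin (n + 1) → ℝ) × (Fin (n + 1) → ℝ)) :=
    {p | ∀ k, powerSpectrum D p.1 k + powerSpectrum D p.2 k =
      powerSpectrum D a k + powerSpectrum D b k}
  let Φ : (Fin (n + 1) → ℝ) × (Fin (n + 1) → ℝ) → ℝ :=
    fun p => ∑ j : Fin (n + 1), ((j : ℕ) : ℝ) * (p.1 j ^ 2 + p.2 j ^ 2)
  have hS : IsClosed S := by
    simp only [S, Set.ofPred_forall]
    exact isClosed_iInter fun k => isClosed_eq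
      (((continuous_powerSpectrum k).comp continuous_fst).add
        ((continuous_powerSpectrum k).comp continuous_snd)) continuous_const
  have hcpt : IsCompact S := by
    refine isCompact_of_sum_sq_le hS
      (∑ k, (powerSpectrum D a k + powerSpectrum D b k)) fun p hp => le_of_eq ?_
    rw [← sum_powerSpectrum hKD, ← sum_powerSpectrum hKD, ← Finset.sum_add_distrib]
    exact Finset.sum_congr rfl fun k _ => hp k
  have hΦ : Continuous Φ := by fun_prop
  obtain ⟨p, hp, hmin⟩ := hcpt.exists_isMinOn ⟨(a, b), fun _ => rfl⟩ hΦ.continuousOn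
  -- The angle is chosen so that the rotated second filter has zero first entry and can be shifted
  -- left.
  obtain ⟨c, s, hcs, h0⟩ := exists_rotation (p.1 0) (p.2 0)
  set a' := c • p.1 + s • p.2 with ha'
  set b' := c • p.2 - s • p.1 with hb'
  have hrot : ∀ k, powerSpectrum D a' k + powerSpectrum D b' k =
      powerSpectrum D a k + powerSpectrum D b k :=
    fun k => (powerSpectrum_rotate p.1 p.2 hcs k).trans (hp k)
  have hΦrot : Φ (a', b') = Φ p := by
    refine Finset.sum_congr rfl fun j _ => ?_
    simp only [ha', hb', Pi.add_apply, Pi.sub_apply, Pi.smul_apply, smul_eq_mul]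
    linear_combination ((j : ℕ) : ℝ) * (p.1 j ^ 2 + p.2 j ^ 2) * hcs
  have hb0 : b' = Fin.cons 0 (Fin.tail b') := by
    conv_lhs => rw [← Fin.cons_self_tail b']
    congr 1
  set t := Fin.tail b' with ht
  have hmem : (a', (Fin.snoc t 0 : Fin (n + 1) → ℝ)) ∈ S := by
    intro k
    show powerSpectrum D a' k + powerSpectrum D (Fin.snoc t 0 : Fin (n + 1) → ℝ) k = _
    rw [← powerSpectrum_cons_zero, ← hb0]
    exact hrot k
  -- The shift lowers the weight of each `t j ^ 2` from `j + 1` to `j`, so minimality forces `∑ t j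
  -- ^ 2 ≤ 0`.
  have hle : Φ (a', b') ≤ Φ (a', Fin.snoc t 0) := hΦrot.trans_le (hmin hmem)
  have hsum : ∑ j, t j ^ 2 ≤ 0 := by
    simp only [Φ, mul_add, Finset.sum_add_distrib, add_le_add_iff_left] at hle
    rw [hb0, Fin.sum_univ_succ, Fin.sum_univ_castSucc] at hle
    simp only [Fin.cons_zero, Fin.cons_succ, Fin.snoc_castSucc, Fin.snoc_last, Fin.val_succ,
      Fin.val_castSucc, Nat.cast_add, Nat.cast_one, add_mul, one_mul, Finset.sum_add_distrib] at hle
    simp only [ne_eq, OfNat.ofNat_ne_zero, not_false_eq_true, zero_pow, mul_zero, zero_add,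
      add_zero] at hle
    linarith
  have ht0 : t = 0 := by
    funext j
    have := (Finset.sum_eq_zero_iff_of_nonneg (fun i _ => sq_nonneg (t i))).1
      (le_antisymm hsum (Finset.sum_nonneg fun _ _ => sq_nonneg _)) j (Finset.mem_univ j)
    simpa using this
  have hb'0 : b' = 0 := by
    rw [hb0, ht0]
    funext j
    refine Fin.cases ?_ (fun i => ?_) j <;> simp
  refine ⟨a', fun k => ?_⟩
  rw [← hrot k, hb'0]
  simp [powerSpectrum, fourierMap_apply]

theorem exists_powerSpectrum_sum {ι : Type*} {D K : ℕ} [NeZero D] (hKD : K ≤ D) (s : Finset ι)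
    (u : ι → Fin K → ℝ) :
    ∃ q : Fin K → ℝ, ∀ k, powerSpectrum D q k = ∑ i ∈ s, powerSpectrum D (u i) k := by
  classical
  induction s using Finset.induction_on with
  | empty => exact ⟨0, fun k => by simp [powerSpectrum, fourierMap_apply]⟩
  | insert i s hi ih =>
    obtain ⟨q, hq⟩ := ih
    obtain ⟨q', hq'⟩ := exists_powerSpectrum_add hKD (u i) q
    exact ⟨q', fun k => by rw [hq', hq, Finset.sum_insert hi]⟩

/-! ### The ℓ¹ upper bound -/

theorem norm_dft_neg {D : ℕ} [NeZero D] (w : Fin D → ℝ) (k : Fin D) :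
    ‖dft w (-k)‖ = ‖dft w k‖ := by
  have h := fourierMap_conj (fun d => (w d : ℂ)) k
  simp only [Complex.conj_ofReal] at h
  rw [dft_eq_fourierMap, h, RCLike.norm_conj]

/-- An even real spectrum is the DFT of a real vector. -/
theorem exists_dft_eq_of_even {D : ℕ} [NeZero D] (h : Fin D → ℝ) (heven : ∀ k, h (-k) = h k) :
    ∃ x : Fin D → ℝ, dft x = fun k => (h k : ℂ) := by
  obtain ⟨x, hx⟩ := fourierMap_surjective D fun k => (h k : ℂ)
  have hconj : (fun j => (starRingEnd ℂ) (x j)) = x := by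
    refine fourierMap_injective D (funext fun k => ?_)
    rw [fourierMap_conj, hx]
    simp [heven]
  refine ⟨fun d => (x d).re, ?_⟩
  rw [dft_eq_fourierMap, ← hx]
  congr 1
  funext d
  exact Complex.conj_eq_iff_re.1 (congrFun hconj d)

/-- The power spectrum of `x` is at most `m` times the sum of the spectra of its `m` windows. -/
theorem powerSpectrum_le_windows {D K m : ℕ} [NeZero D] (hm : D ≤ m * K) (x : Fin D → ℝ)
    (k : Fin D) :
    powerSpectrum D x k ≤ m * ∑ i : Fin m, powerSpectrum D
      (fun j : Fin K => if h : (i : ℕ) * K + j < D then x ⟨i * K + j, h⟩ else 0) k := by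
  set u : Fin m → Fin K → ℝ :=
    fun i j => if h : (i : ℕ) * K + j < D then x ⟨i * K + j, h⟩ else 0 with hu
  let y : ℕ → ℂ := fun l => if h : l < D then dftRoot D ^ ((k : ℕ) * l) * x ⟨l, h⟩ else 0
  have h1 : ∑ j : Fin D, dftRoot D ^ ((k : ℕ) * (j : ℕ)) * (x j : ℂ) =
      ∑ l ∈ Finset.range (m * K), y l := by
    rw [← Finset.sum_subset (Finset.range_subset_range.2 hm) (fun l _ hl => dif_neg (by simpa using hl)),
      Finset.sum_range]
    exact Finset.sum_congr rfl fun j _ => by simp [y]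
  have h2 : ∑ l ∈ Finset.range (m * K), y l = ∑ i : Fin m, ∑ j : Fin K, y (i * K + j) := by
    rw [Finset.sum_range, ← finProdFinEquiv.sum_comp, Fintype.sum_prod_type]
    refine Finset.sum_congr rfl fun i _ => Finset.sum_congr rfl fun j _ => ?_
    simp [finProdFinEquiv, add_comm, mul_comm]
  -- The offset `i * K` of a window contributes only a phase.
  have h3 : fourierMap D D (fun j => (x j : ℂ)) k =
      ∑ i : Fin m, dftRoot D ^ ((k : ℕ) * (i * K)) * fourierMap D K (fun j => (u i j : ℂ)) k := by
    rw [fourierMap_apply, h1, h2, Finset.mul_sum]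
    refine Finset.sum_congr rfl fun i _ => ?_
    rw [fourierMap_apply, mul_left_comm]
    congr 1
    rw [Finset.mul_sum]
    refine Finset.sum_congr rfl fun j _ => ?_
    simp only [y, hu]
    split_ifs with h
    · ring
    · simp
  have h4 : ‖fourierMap D D (fun j => (x j : ℂ)) k‖ ≤
      ∑ i : Fin m, ‖fourierMap D K (fun j => (u i j : ℂ)) k‖ := by
    rw [h3]
    refine (norm_sum_le _ _).trans (le_of_eq (Finset.sum_congr rfl fun i _ => ?_))
    rw [norm_mul, norm_pow, norm_dftRoot, one_pow, one_mul]
  have h5 := sq_sum_le_card_mul_sum_sq (s := (Finset.univ : Finset (Fin m)))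
    (f := fun i => ‖fourierMap D K (fun j => (u i j : ℂ)) k‖)
  rw [Finset.card_univ, Fintype.card_fin] at h5
  exact (pow_le_pow_left₀ (norm_nonneg _) h4 2).trans h5

theorem sum_windows_sq {D K m : ℕ} (hm : D ≤ m * K) (x : Fin D → ℝ) :
    ∑ i : Fin m, ∑ j : Fin K,
      (if h : (i : ℕ) * K + j < D then x ⟨i * K + j, h⟩ else 0) ^ 2 = ∑ d, x d ^ 2 := by
  let y : ℕ → ℝ := fun l => (if h : l < D then x ⟨l, h⟩ else 0) ^ 2
  have h1 : ∑ d, x d ^ 2 = ∑ l ∈ Finset.range (m * K), y l := by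
    rw [← Finset.sum_subset (Finset.range_subset_range.2 hm) (fun l _ hl => ?_),
      Finset.sum_range]
    · exact Finset.sum_congr rfl fun j _ => by simp [y]
    · simp only [y]
      rw [dif_neg (by simpa using hl)]
      simp
  rw [h1, Finset.sum_range, ← finProdFinEquiv.sum_comp, Fintype.sum_prod_type]
  refine Finset.sum_congr rfl fun i _ => Finset.sum_congr rfl fun j _ => ?_
  simp [y, finProdFinEquiv, add_comm, mul_comm]

/-- A filter whose power spectrum dominates `|ŵ| / m` yields a representation of `w`. -/
theorem exists_cyclicConv_eq {D K : ℕ} [NeZero D] (w : Fin D → ℝ) (q : Fin K → ℝ) {m : ℝ}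
    (h : ∀ k, ‖dft w k‖ ≤ m * powerSpectrum D q k) :
    ∃ v : Fin D → ℝ, cyclicConv (fun k => (q k : ℂ)) (fun d => (v d : ℂ)) = (fun d => (w d : ℂ)) ∧
      ∑ d, v d ^ 2 ≤ m * ∑ k, ‖dft w k‖ := by
  -- Where `q̂` vanishes, the quotient is `0` by convention, and `h` forces `ŵ = 0` there too.
  obtain ⟨z, hz⟩ := fourierMap_surjective D
    fun k => dft w k / fourierMap D K (fun j => (q j : ℂ)) k
  have hconv : cyclicConv (fun k => (q k : ℂ)) z = fun d => (w d : ℂ) := by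
    refine fourierMap_injective D (funext fun k => ?_)
    rw [fourierMap_cyclicConv, hz, ← dft_eq_fourierMap]
    by_cases h0 : fourierMap D K (fun j => (q j : ℂ)) k = 0
    · have := h k
      rw [powerSpectrum, h0] at this
      have h1 : dft w k = 0 := norm_le_zero_iff.1 (this.trans (by simp))
      rw [h0, h1]
      simp
    · field_simp
  -- As `q` and `w` are real, taking real parts keeps the convolution equation and does not increase
  -- the norm.
  refine ⟨fun d => (z d).re, ?_, ?_⟩
  · funext d
    have h1 := congrArg Complex.re (congrFun hconv d)
    rw [Complex.ofReal_re] at h1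
    rw [← h1]
    simp only [cyclicConv]
    rw [← Complex.ofReal_one, ← Complex.ofReal_div, Complex.re_ofReal_mul, Complex.re_sum]
    simp only [Complex.re_ofReal_mul]
    push_cast
    rfl
  · calc ∑ d, (z d).re ^ 2 ≤ ∑ d, ‖z d‖ ^ 2 := Finset.sum_le_sum fun d _ =>
          sq_le_sq' (neg_le_of_abs_le (Complex.abs_re_le_norm _))
            (le_of_abs_le (Complex.abs_re_le_norm _))
      _ = ∑ k, ‖dft w k‖ ^ 2 / powerSpectrum D q k := by
          rw [← parseval le_rfl, hz]
          simp only [norm_div, div_pow, powerSpectrum]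
      _ ≤ m * ∑ k, ‖dft w k‖ := by
          rw [Finset.mul_sum]
          refine Finset.sum_le_sum fun k _ => ?_
          have hk := h k
          have h0 := norm_nonneg (dft w k)
          rcases (show 0 ≤ powerSpectrum D q k from sq_nonneg _).eq_or_lt with hp | hp
          · have h1 : ‖dft w k‖ = 0 := le_antisymm (by simpa [← hp] using hk) h0
            simp [h1]
          · rw [div_le_iff₀ hp]
            nlinarith

theorem inducedReg_le_l1 {D K C m : ℕ} [NeZero D] (hKD : K ≤ D) (hC : 1 ≤ C) (hm : D ≤ m * K)
    (w : Fin D → ℝ) :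
    inducedReg K C w ≤ 2 * Real.sqrt (m : ℝ) * ‖WithLp.toLp 1 (dft w)‖ := by
  rw [norm_one_dft]
  -- Taking `x̂ = √|ŵ|`, an even spectrum, makes `x` real with power spectrum `|ŵ|`.
  obtain ⟨x, hx⟩ := exists_dft_eq_of_even (fun k => Real.sqrt ‖dft w k‖)
    fun k => by rw [norm_dft_neg]
  have hxs : ∀ k, powerSpectrum D x k = ‖dft w k‖ := by
    intro k
    rw [powerSpectrum, ← dft_eq_fourierMap, hx, Complex.norm_real, Real.norm_eq_abs, sq_abs,
      Real.sq_sqrt (norm_nonneg _)]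
  obtain ⟨q, hq⟩ := exists_powerSpectrum_sum hKD Finset.univ
    fun (i : Fin m) (j : Fin K) => if h : (i : ℕ) * K + j < D then x ⟨i * K + j, h⟩ else 0
  have hqs : ∑ j, q j ^ 2 = ∑ k, ‖dft w k‖ := by
    rw [← sum_powerSpectrum hKD]
    simp_rw [hq, ← hxs]
    rw [Finset.sum_comm, sum_powerSpectrum le_rfl, ← sum_windows_sq hm x]
    exact Finset.sum_congr rfl fun i _ => sum_powerSpectrum hKD _
  obtain ⟨v, hv, hvs⟩ := exists_cyclicConv_eq w q (m := m) fun k => by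
    rw [← hxs, hq]
    exact powerSpectrum_le_windows hm x k
  have hS : 0 ≤ ∑ k, ‖dft w k‖ := Finset.sum_nonneg fun _ _ => norm_nonneg _
  refine (inducedReg_le_two_mul_sqrt hC q v hv).trans ?_
  rw [hqs, mul_assoc]
  refine mul_le_mul_of_nonneg_left ?_ zero_le_two
  refine (mul_le_mul_of_nonneg_left (Real.sqrt_le_sqrt hvs) (Real.sqrt_nonneg _)).trans
    (le_of_eq ?_)
  rw [Real.sqrt_mul (Nat.cast_nonneg m), mul_left_comm, Real.mul_self_sqrt hS]

theorem le_ceil_div_mul {D K : ℕ} (hK : 1 ≤ K) : D ≤ ⌈(D : ℝ) / (K : ℝ)⌉₊ * K := by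
  have hK' : (0 : ℝ) < K := by exact_mod_cast hK
  have := (div_le_iff₀ hK').1 (Nat.le_ceil ((D : ℝ) / (K : ℝ)))
  exact_mod_cast this

end ConvNet

theorem lemma3 {D K C : ℕ} (hK : 1 ≤ K) (hKD : K ≤ D) (hC : 1 ≤ C) (w : Fin D → ℝ) :
    IsLeast (ConvNet.costs K C w) (ConvNet.inducedReg K C w) ∧
    (2 * Real.sqrt ((D : ℝ) / (K : ℝ)) * ‖WithLp.toLp 2 (ConvNet.dft w)‖
        ≤ ConvNet.inducedReg K C w ∧
      ConvNet.inducedReg K C w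
        ≤ 2 * Real.sqrt (D : ℝ) * ‖WithLp.toLp 2 (ConvNet.dft w)‖) ∧
    (2 * ‖WithLp.toLp 1 (ConvNet.dft w)‖ ≤ ConvNet.inducedReg K C w ∧
      ConvNet.inducedReg K C w
        ≤ 2 * Real.sqrt (⌈(D : ℝ) / (K : ℝ)⌉₊ : ℝ) * ‖WithLp.toLp 1 (ConvNet.dft w)‖) := by
  have : NeZero D := ⟨by omega⟩
  have hleast := ConvNet.isLeast_costs (ConvNet.costs_nonempty hK hC w)
  exact ⟨hleast, ⟨ConvNet.l2_le_of_mem_costs hK hleast.1, ConvNet.inducedReg_le_l2 hK hC w⟩,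
    ConvNet.l1_le_of_mem_costs hKD hleast.1,
    ConvNet.inducedReg_le_l1 hKD hC (ConvNet.le_ceil_div_mul hK) w⟩
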